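/- Let $\mathsf{k}$ be an algebraically closed field (of any characteristic) and $J$ a $\mathsf{k}$-vector space with $\dim J=9$. Let $N$ be a cubic form on $J$, with directional derivative $\partial_yN(x)$, and let $\mathfrak 1\in J$ satisfy $N(\mathfrak 1)=1$. Put $$T(x,y)=-\partial_x\partial_yN(\mathfrak 1)+(\partial_xN(\mathfrak 1))(\partial_yN(\mathfrak 1)),\qquad T(x)=T(x,\mathfrak 1).$$ Suppose that a quadratic map $x\mapsto x^\sharp$ on $J$, with bilinear $\sharp$-product $x\sharp y=(x+y)^\sharp-x^\sharp-y^\sharp$, satisfies for all $x,y\in J$ $$T(x^\sharp,y)=\partial_yN(x),\qquad x^{\sharp\sharp}=N(x)x,\qquad \mathfrak 1\sharp y=T(y)\mathfrak 1-y,$$ and give $J$ the corresponding structure of quadratic Jordan algebra of the cubic form $N$, with unit $\mathfrak 1$ and $U$-operator $U_xy=T(x,y)x-x^\sharp\sharp y$. Assume that (a) $J$ is nondegenerate: if $\sigma\in J$ and $U_\sigma y=0$ for all $y\in J$, then $\sigma=0$; (b) $N(x)\neq 0$ for some $x\neq 0$; (c) $J$ is not isomorphic, as a unital quadratic Jordan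 algebra, to a direct sum $\mathsf{k}\oplus J(Q,\mathfrak 1')$, where $J(Q,\mathfrak 1')$ is the Jordan algebra of a quadratic form $Q$ on a $\mathsf{k}$-vector space $V$ with identity $\mathfrak 1'$, $Q(\mathfrak 1')=1$: its $U$-operator is $U_vw=Q(v,\bar w)v-Q(v)\bar w$, with $Q(v,w)=Q(v+w)-Q(v)-Q(w)$ and $\bar w=Q(w,\mathfrak 1')\mathfrak 1'-w$; on $\mathsf{k}$ the $U$-operator is $U_ab=a^2b$. Let $\upsilon_1,\upsilon_2,\upsilon_3\in J$ be three complementary primitive idempotents, that is, $\upsilon_i\ne0$, $\upsilon_i^\sharp+T(\upsilon_i)\upsilon_i-T(\upsilon_i^\sharp)\mathfrak 1=\upsilon_i$ and $\upsilon_i^\sharp=0$ for $i=1,2,3$, and $\upsilon_1+\upsilon_2+\upsilon_3=\mathfrak 1$. For $i\neq j$ let $J_{ij}=J_{ji}=\{U_{\upsilon_i+\upsilon_j}y-U_{\upsilon_i}y-U_{\upsilon_j}y\mid y\in J\}$ be the Peirce spaces. Then there exist bases $\chi_{11},\chi_{21}$ of $J_{23}$, $\chi_{12},\chi_{22}$ of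 $J_{13}$, $\chi_{13},\chi_{23}$ of $J_{12}$, and $p_{abc}\in\mathsf{k}$ $(a,b,c=1,2)$ such that $$\begin{cases} \chi_{11}\sharp\chi_{12}=p_{221}\chi_{13}+p_{222}\chi_{23}, & \chi_{11}\sharp\chi_{22}=-p_{211}\chi_{13}-p_{212}\chi_{23},\\ \chi_{21}\sharp\chi_{12}=-p_{121}\chi_{13}-p_{122}\chi_{23}, & \chi_{21}\sharp\chi_{22}=p_{111}\chi_{13}+p_{112}\chi_{23}, \end{cases}$$ $$\begin{cases} \chi_{11}\sharp\chi_{13}=p_{212}\chi_{12}+p_{222}\chi_{22}, & \chi_{11}\sharp\chi_{23}=-p_{211}\chi_{12}-p_{221}\chi_{22},\\ \chi_{21}\sharp\chi_{13}=-p_{112}\chi_{12}-p_{122}\chi_{22}, & \chi_{21}\sharp\chi_{23}=p_{111}\chi_{12}+p_{121}\chi_{22}, \end{cases}$$ $$\begin{cases} \chi_{12}\sharp\chi_{13}=p_{122}\chi_{11}+p_{222}\chi_{21}, & \chi_{12}\sharp\chi_{23}=-p_{121}\chi_{11}-p_{221}\chi_{21},\\ \chi_{22}\sharp\chi_{13}=-p_{112}\chi_{11}-p_{212}\chi_{21},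 & \chi_{22}\sharp\chi_{23}=p_{111}\chi_{11}+p_{211}\chi_{21}, \end{cases}$$ $$\begin{cases} \chi_{11}\sharp\chi_{11}=2(-p_{212}p_{221}+p_{211}p_{222})\upsilon_{1},\\ \chi_{11}\sharp\chi_{21}=(-p_{122}p_{211}+p_{121}p_{212}+p_{112}p_{221}-p_{111}p_{222})\upsilon_{1},\\ \chi_{21}\sharp\chi_{21}=2(-p_{112}p_{121}+p_{111}p_{122})\upsilon_{1},\\ \chi_{12}\sharp\chi_{12}=2(-p_{122}p_{221}+p_{121}p_{222})\upsilon_{2},\\ \chi_{12}\sharp\chi_{22}=(p_{122}p_{211}-p_{121}p_{212}+p_{112}p_{221}-p_{111}p_{222})\upsilon_{2},\\ \chi_{22}\sharp\chi_{22}=2(-p_{112}p_{211}+p_{111}p_{212})\upsilon_{2},\\ \chi_{13}\sharp\chi_{13}=2(-p_{122}p_{212}+p_{112}p_{222})\upsilon_{3},\\ \chi_{13}\sharp\chi_{23}=(p_{122}p_{211}+p_{121}p_{212}-p_{112}p_{221}-p_{111}p_{222})\upsilon_{3},\\ \chi_{23}\sharp\chi_{23}=2(-p_{121}p_{211}+p_{111}p_{221})\upsilon_{3}.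 \end{cases}$$ -/

import Mathlib

/-- A cubic form `N` on a `k`-module `J`, presented coordinate-free (in the same style as
Mathlib's `QuadraticMap`): a function `N`, homogeneous of degree 3, together with its
directional derivative `N.D x y = ∂_y N(x)`, which is quadratic in the point `x` and linear in
the direction `y`. Together the laws say that
`N (x + t y) = N x + t ∂_y N(x) + t² ∂_x N(y) + t³ N y` (see `CubicForm.map_add_smul`), so that
`N.D x y` is the coefficient of `t` in `N (x + t y)`, and that Euler's formula holds. -/
structure CubicForm (k : Type*) (J : Type*) [Field k] [AddCommGroup J] [Module k J] where
  /-- the values of the cubic form -/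
  toFun : J → k
  /-- the derivative: `D x y = ∂_y N(x)` -/
  D : QuadraticMap k J (Module.Dual k J)
  map_smul' : ∀ (t : k) (x : J), toFun (t • x) = t ^ 3 * toFun x
  map_add' : ∀ x y : J, toFun (x + y) = toFun x + D x y + D y x + toFun y
  euler' : ∀ x : J, D x x = 3 * toFun x

namespace CubicForm

variable {k : Type*} {J : Type*} [Field k] [AddCommGroup J] [Module k J]

instance : CoeFun (CubicForm k J) (fun _ => J → k) := ⟨CubicForm.toFun⟩

/-- `N.D x y` is the coefficient of `t` in `N (x + t y)`. -/
theorem map_add_smul (N : CubicForm k J) (x y : J) (t : k) :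
    N (x + t • y) = N x + t * N.D x y + t ^ 2 * N.D y x + t ^ 3 * N y := by
  rw [N.map_add', N.map_smul', N.D.map_smul]
  simp [pow_two]

/-- The bilinear trace form of `N` with respect to the base point `c`:
`T(x, y) = - ∂_x ∂_y N(c) + ∂_x N(c) ∂_y N(c)`. As `z ↦ ∂_y N(z)` is quadratic, its derivative
at `c` in the direction `x` is its polarization at `(c, x)`. -/
noncomputable def traceBilin (N : CubicForm k J) (c : J) : J →ₗ[k] J →ₗ[k] k :=
  -(N.D.polarBilin c) + (LinearMap.mul k k).compl₁₂ (N.D c) (N.D c)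

theorem traceBilin_apply (N : CubicForm k J) (c x y : J) :
    N.traceBilin c x y = -(QuadraticMap.polar N.D c x) y + N.D c x * N.D c y := rfl

end CubicForm

/-- The data of the quadratic Jordan algebra of a cubic form on the vector space `J`: a cubic
form `N`, a unit element `one` with `N one = 1`, and a quadratic map `x ↦ x^♯` for which the three
sharp conditions hold. The `U`-operator is `CubicJordan.U`. -/
structure CubicJordan (k : Type*) (J : Type*) [Field k] [AddCommGroup J] [Module k J] where
  /-- the cubic form -/
  N : CubicForm k J
  /-- the unit element -/
  one : J
  /-- the `♯`-mapping -/
  sharp : QuadraticMap k J J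
  N_one : N one = 1
  /-- `T(x^♯, y) = ∂_y N(x)` -/
  sharp_one : ∀ x y : J, N.traceBilin one (sharp x) y = N.D x y
  /-- `x^♯♯ = N(x) x` -/
  sharp_two : ∀ x : J, sharp (sharp x) = N x • x
  /-- `1 ♯ y = T(y) 1 - y`, where `x ♯ y = (x + y)^♯ - x^♯ - y^♯` and `T(y) = T(y, 1)` -/
  sharp_three : ∀ y : J,
    sharp (one + y) - sharp one - sharp y = N.traceBilin one y one • one - y

namespace CubicJordan

variable {k : Type*} {J : Type*} [Field k] [AddCommGroup J] [Module k J]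

/-- The bilinear trace form `T(x, y)`. -/
noncomputable def T (A : CubicJordan k J) : J →ₗ[k] J →ₗ[k] k := A.N.traceBilin A.one

/-- The linear trace form `T(x) = T(x, 1)`. -/
noncomputable def tr (A : CubicJordan k J) (x : J) : k := A.T x A.one

/-- The quadratic spur form `S(x) = T(x^♯)`. -/
noncomputable def S (A : CubicJordan k J) (x : J) : k := A.tr (A.sharp x)

/-- The `♯`-product `x ♯ y = (x + y)^♯ - x^♯ - y^♯`. -/
def sharpMul (A : CubicJordan k J) (x y : J) : J := A.sharp (x + y) - A.sharp x - A.sharp y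

/-- The `U`-operator `U_x y = T(x, y) x - x^♯ ♯ y`, as a linear map in `y`. -/
noncomputable def U (A : CubicJordan k J) (x : J) : J →ₗ[k] J :=
  (A.T x).smulRight x - A.sharp.polarBilin (A.sharp x)

theorem U_apply (A : CubicJordan k J) (x y : J) :
    A.U x y = A.T x y • x - A.sharpMul (A.sharp x) y := rfl

/-- The square `x • x = x^♯ + T(x) x - S(x) 1` (for the product of the Jordan algebra). -/
noncomputable def sq (A : CubicJordan k J) (x : J) : J :=
  A.sharp x + A.tr x • x - A.S x • A.one

/-- Nondegeneracy: the only `σ` with `U_σ = 0` is `σ = 0`. -/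
def Nondegenerate (A : CubicJordan k J) : Prop :=
  ∀ σ : J, (∀ y : J, A.U σ y = 0) → σ = 0

/-- A primitive idempotent: `e ≠ 0`, `e • e = e`, and `e^♯ = 0`. -/
def IsPrimitiveIdempotent (A : CubicJordan k J) (e : J) : Prop :=
  e ≠ 0 ∧ A.sq e = e ∧ A.sharp e = 0

/-- Three complementary primitive idempotents: they add up to the unit element. -/
def AreComplementary (A : CubicJordan k J) (e₁ e₂ e₃ : J) : Prop :=
  A.IsPrimitiveIdempotent e₁ ∧ A.IsPrimitiveIdempotent e₂ ∧ A.IsPrimitiveIdempotent e₃ ∧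
    e₁ + e₂ + e₃ = A.one

/-- The Peirce space `U_{e, f}(J)`, where `U_{e, f} = U_{e + f} - U_e - U_f`. -/
noncomputable def peirce (A : CubicJordan k J) (e f : J) : Submodule k J :=
  LinearMap.range (A.U (e + f) - A.U e - A.U f)

end CubicJordan

/-- The `U`-operator of the Jordan algebra `J(Q, c)` of a quadratic form `Q` with identity `c`
(where `Q c = 1`): `U_v w = Q(v, w̄) v - Q(v) w̄`, with `w̄ = Q(w, c) c - w` and
`Q(v, w) = Q(v + w) - Q(v) - Q(w)`. -/
def quadraticFormU {k V : Type*} [Field k] [AddCommGroup V] [Module k V]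
    (Q : QuadraticForm k V) (c v w : V) : V :=
  QuadraticMap.polar Q v (QuadraticMap.polar Q w c • c - w) • v -
    Q v • (QuadraticMap.polar Q w c • c - w)

/-- `J` is isomorphic, as a unital quadratic Jordan algebra, to a direct sum `k ⊕ J(Q, c)`:
there is a linear bijection which carries the unit element to `(1, c)` and the `U`-operator to
the componentwise `U`-operator (on the summand `k` it is `U_a b = a² b`). The space `V` can be
taken in the universe of `J` because it is isomorphic to a subspace of `J`. -/
def CubicJordan.IsFieldPlusQuadratic.{u, v} {k : Type u} {J : Type v} [Field k] [AddCommGroup J]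
    [Module k J] (A : CubicJordan k J) : Prop :=
  ∃ (V : Type v) (_ : AddCommGroup V) (_ : Module k V) (Q : QuadraticForm k V) (c : V)
    (φ : J ≃ₗ[k] k × V),
    Q c = 1 ∧ φ A.one = (1, c) ∧
      ∀ x y : J, φ (A.U x y) =
        ((φ x).1 ^ 2 * (φ y).1, quadraticFormU Q c (φ x).2 (φ y).2)

/-! ### Symmetry of the polarized cubic form. -/

namespace CubicForm

variable {k : Type*} {J : Type*} [Field k] [AddCommGroup J] [Module k J]

/-! Such an algebra multiplies off the diagonal like the 3 × 3 matrices, so bases made of matrix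
units reduce `p` to the diagonal tensor: `p₁₁₁ = p₂₂₂ = 1` and all other entries zero.

Linearizing `x^♯♯ = N(x) x` yields the Peirce rules (`sharpMul_inPeirce`, `sharp_eq`): the
`♯`-product of two different Peirce spaces lies in the third, and on `J₂₃` the sharp is a quadratic
form `q` times `e₁`. Multiplying twice by `a ∈ J₂₃` acts on `J₁₃` as `-q(a)`
(`sharpMul_sharpMul_same_right`). Nondegeneracy supplies an `a` with `q(a) ≠ 0` in a nonzero `J₂₃`,
so the other two spaces then have equal dimension. Two vanishing Peirce spaces would give `k ⊕ J(Q,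
c)` (`isFieldPlusQuadratic`), so all three have dimension `(9 - 3)/3 = 2`.

Over an algebraically closed field each Peirce space is a hyperbolic plane. A hyperbolic pair of
`J₂₃` splits an anisotropic vector of `J₁₃` into a hyperbolic pair there, and products of the two
pairs give one in `J₁₂` (`exists_matrixUnits`). No step divides by 2. -/

theorem polar_D_apply_rotate (N : CubicForm k J) (x y z : J) :
    QuadraticMap.polar N.D x y z = QuadraticMap.polar N.D y z x := by
  -- Expand `N (x + y + z)` with both bracketings and compare.
  have h1 := N.map_add' (x + y) z
  have h2 := N.map_add' x (y + z)
  rw [N.map_add' x y] at h1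
  rw [N.map_add' y z, ← add_assoc, h1] at h2
  simp only [map_add] at h2
  simp only [QuadraticMap.polar, LinearMap.sub_apply]
  linear_combination h2

theorem polar_D_self_apply (N : CubicForm k J) (c y : J) :
    QuadraticMap.polar N.D c c y = 2 * N.D c y := by
  simp [QuadraticMap.polar_self]

end CubicForm

/-- Over an infinite field, a vector-valued polynomial function of degree at most two which
vanishes off zero has zero coefficients. -/
theorem coeff_eq_zero_of_forall_ne_zero {k V : Type*} [Field k] [Infinite k] [AddCommGroup V]
    [Module k V] {a b c : V} (h : ∀ t : k, t ≠ 0 → a + t • b + t ^ 2 • c = 0) :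
    a = 0 ∧ b = 0 ∧ c = 0 := by
  -- Linear functionals separate points, which reduces the claim to scalar polynomials.
  have key : ∀ f : Module.Dual k V, f a = 0 ∧ f b = 0 ∧ f c = 0 := by
    intro f
    let P : Polynomial k :=
      Polynomial.C (f a) + Polynomial.X * Polynomial.C (f b) +
        Polynomial.X ^ 2 * Polynomial.C (f c)
    have hP : P = 0 := by
      refine Polynomial.eq_zero_of_infinite_isRoot P ?_
      refine (Set.finite_singleton (0 : k)).infinite_compl.mono fun t ht => ?_
      have := congrArg f (h t ht)
      simp only [map_add, map_smul, smul_eq_mul, map_zero] at this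
      simp only [Set.mem_ofPred_eq, Polynomial.IsRoot, P, Polynomial.eval_add, Polynomial.eval_mul,
        Polynomial.eval_C, Polynomial.eval_X, Polynomial.eval_pow]
      exact this
    refine ⟨?_, ?_, ?_⟩
    · simpa [P] using congrArg (fun p => Polynomial.coeff p 0) hP
    · simpa [P, Polynomial.coeff_X_pow_mul', Polynomial.coeff_C] using
        congrArg (fun p => Polynomial.coeff p 1) hP
    · simpa [P, Polynomial.coeff_X_pow_mul', Polynomial.coeff_C] using
        congrArg (fun p => Polynomial.coeff p 2) hP
  exact ⟨(Module.forall_dual_apply_eq_zero_iff k a).1 fun f => (key f).1,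
    (Module.forall_dual_apply_eq_zero_iff k b).1 fun f => (key f).2.1,
    (Module.forall_dual_apply_eq_zero_iff k c).1 fun f => (key f).2.2⟩

/-! ### Calculus of the `♯`-product and the linearized adjoint identities. -/

namespace CubicJordan

variable {k : Type*} {J : Type*} [Field k] [AddCommGroup J] [Module k J]
variable (A : CubicJordan k J)

theorem sharpMul_eq_polar (x y : J) : A.sharpMul x y = A.sharp.polarBilin x y := rfl

theorem sharpMul_comm (x y : J) : A.sharpMul x y = A.sharpMul y x :=
  QuadraticMap.polar_comm _ _ _

theorem sharpMul_add_left (x y z : J) :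
    A.sharpMul (x + y) z = A.sharpMul x z + A.sharpMul y z := by
  simp [sharpMul_eq_polar, -QuadraticMap.polarBilin_apply_apply]

theorem sharpMul_add_right (x y z : J) :
    A.sharpMul x (y + z) = A.sharpMul x y + A.sharpMul x z := by
  simp [sharpMul_eq_polar, -QuadraticMap.polarBilin_apply_apply]

theorem sharpMul_sub_left (x y z : J) :
    A.sharpMul (x - y) z = A.sharpMul x z - A.sharpMul y z := by
  simp [sharpMul_eq_polar, -QuadraticMap.polarBilin_apply_apply]

theorem sharpMul_sub_right (x y z : J) :
    A.sharpMul x (y - z) = A.sharpMul x y - A.sharpMul x z := by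
  simp [sharpMul_eq_polar, -QuadraticMap.polarBilin_apply_apply]

theorem sharpMul_neg_left (x z : J) : A.sharpMul (-x) z = -A.sharpMul x z := by
  simp [sharpMul_eq_polar, -QuadraticMap.polarBilin_apply_apply]

theorem sharpMul_neg_right (x z : J) : A.sharpMul x (-z) = -A.sharpMul x z := by
  simp [sharpMul_eq_polar, -QuadraticMap.polarBilin_apply_apply]

theorem sharpMul_smul_left (t : k) (x z : J) : A.sharpMul (t • x) z = t • A.sharpMul x z := by
  simp [sharpMul_eq_polar, -QuadraticMap.polarBilin_apply_apply]

theorem sharpMul_smul_right (t : k) (x z : J) : A.sharpMul x (t • z) = t • A.sharpMul x z := by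
  simp [sharpMul_eq_polar, -QuadraticMap.polarBilin_apply_apply]

theorem sharpMul_zero_left (z : J) : A.sharpMul 0 z = 0 := by
  simp [sharpMul_eq_polar, -QuadraticMap.polarBilin_apply_apply]

theorem sharpMul_zero_right (z : J) : A.sharpMul z 0 = 0 := by
  simp [sharpMul_eq_polar, -QuadraticMap.polarBilin_apply_apply]

theorem sharpMul_self (x : J) : A.sharpMul x x = (2 : k) • A.sharp x := by
  rw [two_smul, ← two_nsmul]
  exact QuadraticMap.polar_self _ _

theorem sharp_add (x y : J) : A.sharp (x + y) = A.sharp x + A.sharp y + A.sharpMul x y := by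
  simp [sharpMul]

theorem sharp_smul (t : k) (x : J) : A.sharp (t • x) = t ^ 2 • A.sharp x := by
  rw [QuadraticMap.map_smul, pow_two]

theorem one_sharpMul (y : J) : A.sharpMul A.one y = A.tr y • A.one - y :=
  A.sharp_three y

theorem T_sharp (x y : J) : A.T (A.sharp x) y = A.N.D x y := A.sharp_one x y

theorem T_sharpMul (x y z : J) : A.T (A.sharpMul x y) z = QuadraticMap.polar A.N.D x y z := by
  simp [sharpMul, QuadraticMap.polar, T_sharp]

/-- Both sides are values of the symmetric trilinear form polarizing `N`. The symmetry of `T` itself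
follows from this. -/
theorem T_sharpMul_rotate (x y z : J) : A.T (A.sharpMul x y) z = A.T (A.sharpMul y z) x := by
  rw [T_sharpMul, T_sharpMul, CubicForm.polar_D_apply_rotate]

theorem T_apply (x y : J) :
    A.T x y = -A.T (A.sharpMul A.one x) y + A.N.D A.one x * A.N.D A.one y := by
  rw [T_sharpMul]; exact A.N.traceBilin_apply A.one x y

theorem T_comm (x y : J) : A.T x y = A.T y x := by
  rw [T_apply A x, T_apply A y, T_sharpMul_rotate A A.one x y, sharpMul_comm A x y,
    ← T_sharpMul_rotate A A.one y x, mul_comm]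

theorem T_sharpMul_right (u x y : J) : A.T u (A.sharpMul x y) = A.T (A.sharpMul x u) y := by
  rw [T_comm, T_sharpMul_rotate, T_sharpMul_rotate, sharpMul_comm]

theorem T_one_left (y : J) : A.T A.one y = A.N.D A.one y := by
  rw [T_apply, T_sharpMul, CubicForm.polar_D_self_apply, A.N.euler', A.N_one]
  ring

theorem tr_eq (y : J) : A.tr y = A.N.D A.one y := by
  rw [tr, T_comm, T_one_left]

theorem T_eq (x y : J) : A.T x y = A.tr x * A.tr y - A.tr (A.sharpMul x y) := by
  rw [T_apply, ← tr_eq, ← tr_eq, T_sharpMul_rotate, tr, tr, tr]; ring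

theorem tr_smul (t : k) (x : J) : A.tr (t • x) = t * A.tr x := by simp [tr]

section Infinite

variable [Infinite k]

/-- These are the coefficients of `t` and `t²` in `(x + t y)^♯♯ = N(x + t y)(x + t y)`. The terms in
`t⁰` and `t⁴` cancel by the identity for `x` and `y`; dividing by `t ≠ 0` leaves degree two. -/
theorem sharp_linearize (x y : J) :
    A.sharpMul (A.sharp x) (A.sharpMul x y) = A.N x • y + A.T (A.sharp x) y • x ∧
    A.sharp (A.sharpMul x y) + A.sharpMul (A.sharp x) (A.sharp y) =
      A.T (A.sharp x) y • y + A.T (A.sharp y) x • x := by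
  have key := coeff_eq_zero_of_forall_ne_zero (k := k)
    (a := A.sharpMul (A.sharp x) (A.sharpMul x y) - (A.N x • y + A.T (A.sharp x) y • x))
    (b := A.sharp (A.sharpMul x y) + A.sharpMul (A.sharp x) (A.sharp y) -
      (A.T (A.sharp x) y • y + A.T (A.sharp y) x • x))
    (c := A.sharpMul (A.sharp y) (A.sharpMul x y) - (A.N y • x + A.T (A.sharp y) x • y)) ?_
  · exact ⟨sub_eq_zero.1 key.1, sub_eq_zero.1 key.2.1⟩
  intro t ht
  have h := A.sharp_two (x + t • y)
  rw [A.N.map_add_smul] at h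
  simp only [sharp_add, sharp_smul, sharpMul_add_left, sharpMul_smul_left,
    sharpMul_smul_right, A.sharp_two, ← T_sharp] at h
  refine (smul_eq_zero.1 (?_ : t • (_ : J) = 0)).resolve_left ht
  linear_combination (norm := module) h

theorem sharp_sharpMul (x y : J) :
    A.sharp (A.sharpMul x y) + A.sharpMul (A.sharp x) (A.sharp y) =
      A.T (A.sharp x) y • y + A.T (A.sharp y) x • x := (A.sharp_linearize x y).2

/-- Replace `x` by `x + t z` in the first identity of `sharp_linearize` and take the coefficient of
`t`. -/
theorem sharpMul_sharpMul_same (x y z : J) :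
    A.sharpMul (A.sharpMul x z) (A.sharpMul x y) + A.sharpMul (A.sharp x) (A.sharpMul z y) =
      A.T (A.sharp x) z • y + A.T (A.sharp x) y • z + A.T (A.sharpMul x z) y • x := by
  have key := coeff_eq_zero_of_forall_ne_zero (k := k) (c := (0 : J))
    (a := A.sharpMul (A.sharpMul x z) (A.sharpMul x y) +
      A.sharpMul (A.sharp x) (A.sharpMul z y) -
      (A.T (A.sharp x) z • y + A.T (A.sharp x) y • z + A.T (A.sharpMul x z) y • x))
    (b := A.sharpMul (A.sharpMul z x) (A.sharpMul z y) +
      A.sharpMul (A.sharp z) (A.sharpMul x y) -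
      (A.T (A.sharp z) x • y + A.T (A.sharp z) y • x + A.T (A.sharpMul z x) y • z)) ?_
  · exact sub_eq_zero.1 key.1
  intro t ht
  have h := (A.sharp_linearize (x + t • z) y).1
  have h1 := (A.sharp_linearize x y).1
  have h2 := (A.sharp_linearize z y).1
  rw [A.N.map_add_smul] at h
  simp only [sharp_add, sharp_smul, sharpMul_add_left, sharpMul_add_right, sharpMul_smul_left,
    sharpMul_smul_right, ← T_sharp, map_add, map_smul, LinearMap.add_apply,
    LinearMap.smul_apply, smul_eq_mul] at h
  refine (smul_eq_zero.1 (?_ : t • (_ : J) = 0)).resolve_left ht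
  rw [sharpMul_comm A z x]
  linear_combination (norm := module) h - h1 - t ^ 3 • h2

theorem sharpMul_sharpMul (x y z w : J) :
    A.sharpMul (A.sharpMul x z) (A.sharpMul w y) + A.sharpMul (A.sharpMul w z) (A.sharpMul x y) +
      A.sharpMul (A.sharpMul x w) (A.sharpMul z y) =
      A.T (A.sharpMul x w) z • y + A.T (A.sharpMul x w) y • z + A.T (A.sharpMul x z) y • w +
        A.T (A.sharpMul w z) y • x := by
  have h := A.sharpMul_sharpMul_same (x + w) y z
  have h1 := A.sharpMul_sharpMul_same x y z
  have h2 := A.sharpMul_sharpMul_same w y z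
  simp only [sharp_add, sharpMul_add_left, sharpMul_add_right, map_add, LinearMap.add_apply] at h
  linear_combination (norm := module) h - h1 - h2

end Infinite

/-- The difference `d = 1^♯ - 1` is in the radical of `T`, and expanding `(1 + d)^♯ = 1^♯♯ = 1`
gives `d^♯ = 0`. Hence `U_d = 0`, and nondegeneracy applies. -/
theorem sharp_one_eq (ha : A.Nondegenerate) : A.sharp A.one = A.one := by
  have hT : ∀ y, A.T (A.sharp A.one - A.one) y = 0 := fun y => by
    rw [map_sub, LinearMap.sub_apply, T_sharp, T_one_left, sub_self]
  set d := A.sharp A.one - A.one with hd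
  have hu : A.sharp A.one = A.one + d := by rw [hd]; abel
  have hdd : A.sharp d = 0 := by
    have h := A.sharp_two A.one
    rw [hu, sharp_add, hu, one_sharpMul, A.N_one, one_smul] at h
    rw [tr, hT] at h
    linear_combination (norm := module) h
  have : d = 0 := ha d fun y => by
    rw [U_apply, hT, hdd, sharpMul_zero_left, zero_smul, sub_zero]
  rw [hu, this, add_zero]

end CubicJordan

/-! ### Frames, Peirce spaces and their multiplication rules. -/

namespace CubicJordan

variable {k : Type*} {J : Type*} [Field k] [AddCommGroup J] [Module k J]

/-- The multiplication rules of three complementary primitive idempotents. -/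
structure IsFrame (A : CubicJordan k J) (e₁ e₂ e₃ : J) : Prop where
  sharp₁ : A.sharp e₁ = 0
  sharp₂ : A.sharp e₂ = 0
  sharp₃ : A.sharp e₃ = 0
  tr₁ : A.tr e₁ = 1
  tr₂ : A.tr e₂ = 1
  tr₃ : A.tr e₃ = 1
  mul₁₂ : A.sharpMul e₁ e₂ = e₃
  mul₁₃ : A.sharpMul e₁ e₃ = e₂
  mul₂₃ : A.sharpMul e₂ e₃ = e₁
  sum : e₁ + e₂ + e₃ = A.one

/-- The Peirce space `J₂₃` of a frame, described by trace and `♯`-multiplication conditions. -/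
structure InPeirce (A : CubicJordan k J) (e₁ e₂ e₃ x : J) : Prop where
  T₁ : A.T e₁ x = 0
  T₂ : A.T e₂ x = 0
  T₃ : A.T e₃ x = 0
  mul₁ : A.sharpMul e₁ x = -x
  mul₂ : A.sharpMul e₂ x = 0
  mul₃ : A.sharpMul e₃ x = 0

variable {A : CubicJordan k J} {e₁ e₂ e₃ : J}

theorem IsPrimitiveIdempotent.tr_eq_one {e : J} (h : A.IsPrimitiveIdempotent e) :
    A.tr e = 1 := by
  obtain ⟨h0, h1, h2⟩ := h
  have h3 : A.tr e • e = e := by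
    simpa [sq, S, h2, tr] using h1
  have h4 : (A.tr e - 1) • e = 0 := by rw [sub_smul, h3, one_smul, sub_self]
  exact sub_eq_zero.1 ((smul_eq_zero.1 h4).resolve_right h0)

/-- Since `e^♯ = f^♯ = 0`, the product is `(e + f)^♯ = (1 - g)^♯ = 1 - (1 - g)`. -/
theorem sharpMul_eq_of_sum (h1 : A.sharp A.one = A.one) {e f g : J} (he : A.sharp e = 0)
    (hf : A.sharp f = 0) (hg : A.sharp g = 0) (htg : A.tr g = 1) (h : e + f + g = A.one) :
    A.sharpMul e f = g := by
  have hef : e + f = A.one - g := by rw [← h]; abel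
  have h2 : A.sharp (A.one - g) = A.one + -(A.one - g) := by
    rw [sub_eq_add_neg, sharp_add, h1, sharpMul_neg_right, one_sharpMul, htg,
      QuadraticMap.map_neg, hg]
    module
  rw [sharpMul, he, hf, hef, h2]
  abel

theorem AreComplementary.isFrame (ha : A.Nondegenerate) (h : A.AreComplementary e₁ e₂ e₃) :
    A.IsFrame e₁ e₂ e₃ := by
  obtain ⟨h1, h2, h3, hs⟩ := h
  have h0 := A.sharp_one_eq ha
  exact ⟨h1.2.2, h2.2.2, h3.2.2, h1.tr_eq_one, h2.tr_eq_one, h3.tr_eq_one,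
    sharpMul_eq_of_sum h0 h1.2.2 h2.2.2 h3.2.2 h3.tr_eq_one hs,
    sharpMul_eq_of_sum h0 h1.2.2 h3.2.2 h2.2.2 h2.tr_eq_one (by rw [← hs]; abel),
    sharpMul_eq_of_sum h0 h2.2.2 h3.2.2 h1.2.2 h1.tr_eq_one (by rw [← hs]; abel), hs⟩

namespace InPeirce

theorem swap {x : J} (h : A.InPeirce e₁ e₂ e₃ x) : A.InPeirce e₁ e₃ e₂ x :=
  ⟨h.T₁, h.T₃, h.T₂, h.mul₁, h.mul₃, h.mul₂⟩

theorem add {x y : J} (hx : A.InPeirce e₁ e₂ e₃ x) (hy : A.InPeirce e₁ e₂ e₃ y) :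
    A.InPeirce e₁ e₂ e₃ (x + y) := by
  constructor <;> simp [sharpMul_add_right, hx.T₁, hx.T₂, hx.T₃, hy.T₁, hy.T₂, hy.T₃, hx.mul₁,
    hx.mul₂, hx.mul₃, hy.mul₁, hy.mul₂, hy.mul₃]
  abel

theorem smul {x : J} (hx : A.InPeirce e₁ e₂ e₃ x) (t : k) :
    A.InPeirce e₁ e₂ e₃ (t • x) := by
  constructor <;> simp [sharpMul_smul_right, hx.T₁, hx.T₂, hx.T₃, hx.mul₁, hx.mul₂, hx.mul₃]

end InPeirce

namespace IsFrame

theorem swap₂₃ (h : A.IsFrame e₁ e₂ e₃) : A.IsFrame e₁ e₃ e₂ :=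
  ⟨h.sharp₁, h.sharp₃, h.sharp₂, h.tr₁, h.tr₃, h.tr₂, h.mul₁₃, h.mul₁₂,
    by rw [sharpMul_comm, h.mul₂₃], by rw [← h.sum]; abel⟩

theorem swap₁₂ (h : A.IsFrame e₁ e₂ e₃) : A.IsFrame e₂ e₁ e₃ :=
  ⟨h.sharp₂, h.sharp₁, h.sharp₃, h.tr₂, h.tr₁, h.tr₃, by rw [sharpMul_comm, h.mul₁₂], h.mul₂₃,
    h.mul₁₃, by rw [← h.sum]; abel⟩

theorem T_self (h : A.IsFrame e₁ e₂ e₃) : A.T e₁ e₁ = 1 := by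
  rw [T_eq, sharpMul_self, h.sharp₁, h.tr₁]; simp [tr]

theorem T₁₂ (h : A.IsFrame e₁ e₂ e₃) : A.T e₁ e₂ = 0 := by
  rw [T_eq, h.mul₁₂, h.tr₁, h.tr₂, h.tr₃]; simp

theorem T₁₃ (h : A.IsFrame e₁ e₂ e₃) : A.T e₁ e₃ = 0 := h.swap₂₃.T₁₂

theorem U_apply_eq (h : A.IsFrame e₁ e₂ e₃) (y : J) :
    (A.U (e₂ + e₃) - A.U e₂ - A.U e₃) y =
      A.T e₂ y • e₃ + A.T e₃ y • e₂ - A.sharpMul e₁ y := by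
  simp only [LinearMap.sub_apply, U_apply, sharp_add, h.sharp₂, h.sharp₃, h.mul₂₃, map_add,
    LinearMap.add_apply, sharpMul_zero_left, zero_add]
  module

theorem tr_eq_sum (h : A.IsFrame e₁ e₂ e₃) (x : J) :
    A.tr x = A.T e₁ x + A.T e₂ x + A.T e₃ x := by
  rw [tr, T_comm, ← h.sum]; simp

theorem tr_eq_zero (h : A.IsFrame e₁ e₂ e₃) {x : J} (hx : A.InPeirce e₁ e₂ e₃ x) :
    A.tr x = 0 := by
  rw [h.tr_eq_sum, hx.T₁, hx.T₂, hx.T₃]; simp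

/-- This is `1 ♯ y = T(y) 1 - y` with `1` written as `e₁ + e₂ + e₃`. -/
theorem decomposition (h : A.IsFrame e₁ e₂ e₃) (y : J) :
    y = A.T e₁ y • e₁ + A.T e₂ y • e₂ + A.T e₃ y • e₃ +
      (A.T e₂ y • e₃ + A.T e₃ y • e₂ - A.sharpMul e₁ y) +
      (A.T e₁ y • e₃ + A.T e₃ y • e₁ - A.sharpMul e₂ y) +
      (A.T e₁ y • e₂ + A.T e₂ y • e₁ - A.sharpMul e₃ y) := by
  have h1 := A.one_sharpMul y
  rw [h.tr_eq_sum, ← h.sum, sharpMul_add_left, sharpMul_add_left] at h1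
  linear_combination (norm := module) h1

variable [Infinite k]

theorem sharpMul_sharpMul_self (h : A.IsFrame e₁ e₂ e₃) (y : J) :
    A.sharpMul e₁ (A.sharpMul e₁ y) =
      (A.tr y - A.T e₁ y) • (A.one - e₁) - A.sharpMul e₁ y := by
  have h1 := A.sharpMul_sharpMul_same e₁ y A.one
  rw [h.sharp₁, sharpMul_comm A e₁ A.one, one_sharpMul, h.tr₁] at h1
  simp only [sharpMul_sub_left, one_sharpMul, sharpMul_zero_left, map_zero,
    LinearMap.zero_apply, map_sub, LinearMap.sub_apply, zero_smul, one_smul] at h1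
  have h2 : A.tr (A.sharpMul e₁ y) = A.tr y - A.T e₁ y := by
    have := A.T_eq e₁ y
    rw [h.tr₁] at this
    linear_combination this
  rw [T_comm A A.one, ← tr] at h1
  rw [h2] at h1
  linear_combination (norm := module) -h1

theorem sharpMul_sharpMul_of_ne (h : A.IsFrame e₁ e₂ e₃) (y : J) :
    A.sharpMul e₃ (A.sharpMul e₁ y) = A.T e₃ y • e₁ := by
  have h1 := A.sharpMul_sharpMul_same e₁ y e₂
  rw [h.sharp₁, h.mul₁₂] at h1
  simpa [sharpMul_zero_left] using h1

/-- The component of `y` in the Peirce space `J₂₃`. -/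
theorem inPeirce_proj (h : A.IsFrame e₁ e₂ e₃) (y : J) :
    A.InPeirce e₁ e₂ e₃ (A.T e₂ y • e₃ + A.T e₃ y • e₂ - A.sharpMul e₁ y) := by
  constructor
  · simp [T_sharpMul_right, h.T₁₂, h.T₁₃, sharpMul_self, h.sharp₁]
  · simp [T_sharpMul_right, h.mul₁₂, h.swap₁₂.T_self, h.swap₁₂.T₁₃]
  · simp [T_sharpMul_right, h.mul₁₃, h.swap₂₃.swap₁₂.T_self, h.swap₂₃.swap₁₂.T₁₃]
  · simp only [sharpMul_sub_right, sharpMul_add_right, sharpMul_smul_right, h.mul₁₂, h.mul₁₃,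
      h.sharpMul_sharpMul_self, h.tr_eq_sum, ← h.sum]
    module
  · simp [sharpMul_sub_right, sharpMul_add_right, sharpMul_smul_right,
      h.swap₂₃.sharpMul_sharpMul_of_ne, h.mul₂₃, sharpMul_self, h.sharp₂]
  · simp [sharpMul_sub_right, sharpMul_add_right, sharpMul_smul_right,
      h.sharpMul_sharpMul_of_ne, sharpMul_comm A e₃ e₂, h.mul₂₃, sharpMul_self, h.sharp₃]

/-- The Peirce operator lands in the space cut out by the equations and is the identity there, so
equations may replace the image from here on. -/
theorem mem_peirce_iff (h : A.IsFrame e₁ e₂ e₃) (x : J) :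
    x ∈ A.peirce e₂ e₃ ↔ A.InPeirce e₁ e₂ e₃ x := by
  constructor
  · rintro ⟨y, rfl⟩
    rw [h.U_apply_eq]
    exact h.inPeirce_proj y
  · intro hx
    refine ⟨x, ?_⟩
    rw [h.U_apply_eq, hx.T₂, hx.T₃, hx.mul₁]
    simp

/-- The `♯`-product maps `J₂₃ × J₁₃` to `J₁₂`. -/
theorem sharpMul_inPeirce (h : A.IsFrame e₁ e₂ e₃) {a x : J} (ha : A.InPeirce e₁ e₂ e₃ a)
    (hx : A.InPeirce e₂ e₁ e₃ x) : A.InPeirce e₃ e₁ e₂ (A.sharpMul a x) := by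
  have t (u : J) : A.T u (A.sharpMul a x) = A.T (A.sharpMul u a) x := by
    rw [T_comm, T_sharpMul_rotate, T_sharpMul_rotate]
  have t' (u : J) : A.T u (A.sharpMul a x) = A.T (A.sharpMul u x) a := by
    rw [sharpMul_comm A a x, T_comm, T_sharpMul_rotate, T_sharpMul_rotate]
  have t1 : A.T e₁ (A.sharpMul a x) = 0 := by rw [t', hx.mul₂]; simp
  have t2 : A.T e₂ (A.sharpMul a x) = 0 := by rw [t, ha.mul₂]; simp
  have t3 : A.T e₃ (A.sharpMul a x) = 0 := by rw [t, ha.mul₃]; simp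
  have tra : A.tr a = 0 := h.tr_eq_zero ha
  have trx : A.tr x = 0 := h.swap₁₂.tr_eq_zero hx
  have tra' : A.T A.one a = 0 := by rw [T_comm]; exact tra
  have trx' : A.T A.one x = 0 := by rw [T_comm]; exact trx
  have tr0 : A.tr (A.sharpMul a x) = 0 := by rw [h.tr_eq_sum, t1, t2, t3]; simp
  have ax : A.T a x = 0 := by rw [T_eq, tra, trx, tr0]; simp
  -- If `e ♯` has eigenvalue `s` on `a` and `r` on `x`, the full linearization with one argument
  -- equal to `1` gives the eigenvalue `-(1 + s + r)` on `a ♯ x`.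
  have key (e : J) (s r : k) (he : A.tr e = 1) (hs : A.sharpMul e a = s • a)
      (hr : A.sharpMul e x = r • x) (hex : A.T e x = 0) :
      A.sharpMul e (A.sharpMul a x) = -(1 + s + r) • A.sharpMul a x := by
    have h1 := A.sharpMul_sharpMul e x A.one a
    rw [sharpMul_comm A e A.one, one_sharpMul, sharpMul_comm A a A.one, one_sharpMul, hs, hr,
      one_sharpMul, he, tra, trx] at h1
    simp only [sharpMul_sub_left, one_sharpMul, tr0, sharpMul_smul_left, sharpMul_smul_right,
      sharpMul_sub_right, sharpMul_zero_left, sharpMul_zero_right, map_sub, map_smul,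
      LinearMap.sub_apply, LinearMap.smul_apply, ax, trx', hex, zero_smul, smul_zero,
      map_zero, LinearMap.zero_apply, T_comm A a, tra'] at h1
    linear_combination (norm := module) -h1
  refine ⟨t3, t1, t2, ?_, ?_, ?_⟩
  · rw [key e₃ 0 0 h.tr₃ (by simp [ha.mul₃]) (by simp [hx.mul₃]) hx.T₃]
    module
  · rw [key e₁ (-1) 0 h.tr₁ (by simp [ha.mul₁]) (by simp [hx.mul₂]) hx.T₂]
    module
  · rw [key e₂ 0 (-1) h.tr₂ (by simp [ha.mul₂]) (by simp [hx.mul₁]) hx.T₁]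
    module

theorem T_eq_zero (h : A.IsFrame e₁ e₂ e₃) {a x : J} (ha : A.InPeirce e₁ e₂ e₃ a)
    (hx : A.InPeirce e₂ e₁ e₃ x) : A.T a x = 0 := by
  rw [T_eq, h.tr_eq_zero ha, h.swap₂₃.swap₁₂.tr_eq_zero (h.sharpMul_inPeirce ha hx)]; simp

/-- Apply `sharp_sharpMul` to `e₁` and `a`, where `e₁ ♯ a = -a` and `e₁^♯ = 0`. The coefficient is
the quadratic form `q` of `J₂₃`. -/
theorem sharp_eq (h : A.IsFrame e₁ e₂ e₃) {a : J} (ha : A.InPeirce e₁ e₂ e₃ a) :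
    A.sharp a = A.T e₁ (A.sharp a) • e₁ := by
  have h1 := A.sharp_sharpMul e₁ a
  rw [h.sharp₁, ha.mul₁, QuadraticMap.map_neg, sharpMul_zero_left, T_comm A (A.sharp a)] at h1
  simpa using h1

theorem sharpMul_eq (h : A.IsFrame e₁ e₂ e₃) {a b : J} (ha : A.InPeirce e₁ e₂ e₃ a)
    (hb : A.InPeirce e₁ e₂ e₃ b) : A.sharpMul a b = A.T e₁ (A.sharpMul a b) • e₁ := by
  have h1 := h.sharp_eq (ha.add hb)
  have h2 := h.sharp_eq ha
  have h3 := h.sharp_eq hb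
  rw [sharp_add, map_add, map_add] at h1
  linear_combination (norm := module) h1 - h2 - h3

/-- A Clifford relation, obtained from `sharpMul_sharpMul_same` with third argument `1`. It makes
multiplication by an anisotropic `a` injective. -/
theorem sharpMul_sharpMul_same_right (h : A.IsFrame e₁ e₂ e₃) {a x : J}
    (ha : A.InPeirce e₁ e₂ e₃ a) (hx : A.InPeirce e₂ e₁ e₃ x) :
    A.sharpMul a (A.sharpMul a x) = -A.T e₁ (A.sharp a) • x := by
  have tra : A.tr a = 0 := h.tr_eq_zero ha
  have trx : A.tr x = 0 := h.swap₁₂.tr_eq_zero hx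
  have ax : A.T a x = 0 := h.T_eq_zero ha hx
  have h1 := A.sharpMul_sharpMul_same a x A.one
  rw [sharpMul_comm A a A.one, one_sharpMul, tra, one_sharpMul, trx, h.sharp_eq ha] at h1
  simp only [zero_smul, zero_sub, sharpMul_neg_left, sharpMul_neg_right, sharpMul_smul_left,
    hx.mul₂, map_smul, LinearMap.smul_apply, hx.T₂, map_neg, LinearMap.neg_apply, ax,
    show A.T e₁ A.one = 1 from h.tr₁, smul_zero, neg_zero, add_zero, smul_eq_mul, mul_one,
    mul_zero] at h1
  linear_combination (norm := module) -h1

theorem sharpMul_sharpMul_add_swap (h : A.IsFrame e₁ e₂ e₃) {a b x : J}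
    (ha : A.InPeirce e₁ e₂ e₃ a) (hb : A.InPeirce e₁ e₂ e₃ b) (hx : A.InPeirce e₂ e₁ e₃ x) :
    A.sharpMul a (A.sharpMul b x) + A.sharpMul b (A.sharpMul a x) =
      -A.T e₁ (A.sharpMul a b) • x := by
  have h1 := h.sharpMul_sharpMul_same_right (ha.add hb) hx
  have h2 := h.sharpMul_sharpMul_same_right ha hx
  have h3 := h.sharpMul_sharpMul_same_right hb hx
  simp only [sharp_add, map_add, sharpMul_add_left, sharpMul_add_right] at h1
  linear_combination (norm := module) h1 - h2 - h3

/-- A nonzero element of a Peirce space is not in the radical of the quadratic form there. -/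
theorem eq_zero_of_radical (h : A.IsFrame e₁ e₂ e₃) (hA : A.Nondegenerate) {a : J}
    (ha : A.InPeirce e₁ e₂ e₃ a) (hs : A.sharp a = 0)
    (hr : ∀ b, A.InPeirce e₁ e₂ e₃ b → A.sharpMul a b = 0) : a = 0 := by
  -- With `a^♯ = 0` only `T(a, y) a` is left of `U_a y`. The form `T(a, ·)` vanishes on `J₂₃` by
  -- `hr` and on the other Peirce components by orthogonality.
  refine hA a fun y => ?_
  rw [U_apply, hs, sharpMul_zero_left, sub_zero]
  have tra : A.tr a = 0 := h.tr_eq_zero ha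
  have key (z : J) (hz : A.InPeirce e₁ e₂ e₃ z) : A.T a z = 0 := by
    rw [T_eq, tra, hr z hz]; simp [tr]
  have : A.T a y = 0 := by
    rw [h.decomposition y]
    simp only [map_add]
    rw [key _ (h.inPeirce_proj y), h.T_eq_zero ha (h.swap₁₂.inPeirce_proj y),
      h.swap₂₃.T_eq_zero ha.swap (h.swap₂₃.swap₁₂.inPeirce_proj y)]
    simp [T_comm A a, ha.T₁, ha.T₂, ha.T₃]
  rw [this, zero_smul]

end IsFrame

end CubicJordan

/-! ### Dimensions of the Peirce spaces. -/

namespace CubicJordan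

variable {k : Type*} {J : Type*} [Field k] [AddCommGroup J] [Module k J]
variable {A : CubicJordan k J} {e₁ e₂ e₃ : J}

theorem peirce_comm (e f : J) : A.peirce e f = A.peirce f e := by
  rw [peirce, peirce, add_comm, sub_right_comm]

namespace IsFrame

variable [Infinite k]

theorem exists_sharp_ne_zero (h : A.IsFrame e₁ e₂ e₃) (hA : A.Nondegenerate)
    (hne : A.peirce e₂ e₃ ≠ ⊥) : ∃ a, A.InPeirce e₁ e₂ e₃ a ∧ A.T e₁ (A.sharp a) ≠ 0 := by
  by_contra! hq
  have hs : ∀ a, A.InPeirce e₁ e₂ e₃ a → A.sharp a = 0 := fun a ha => by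
    rw [h.sharp_eq ha, hq a ha, zero_smul]
  obtain ⟨x, hx, hx0⟩ := Submodule.exists_mem_ne_zero_of_ne_bot hne
  rw [h.mem_peirce_iff] at hx
  refine hx0 (h.eq_zero_of_radical hA hx (hs x hx) fun b hb => ?_)
  rw [sharpMul, hs _ (hx.add hb), hs x hx, hs b hb]
  simp

theorem finrank_le [Module.Finite k J] (h : A.IsFrame e₁ e₂ e₃) (hA : A.Nondegenerate)
    (hne : A.peirce e₂ e₃ ≠ ⊥) :
    Module.finrank k (A.peirce e₁ e₃) ≤ Module.finrank k (A.peirce e₁ e₂) := by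
  obtain ⟨a, ha, hq⟩ := h.exists_sharp_ne_zero hA hne
  have hmap : ∀ x ∈ A.peirce e₁ e₃, A.sharp.polarBilin a x ∈ A.peirce e₁ e₂ := by
    intro x hx
    rw [h.swap₁₂.mem_peirce_iff] at hx
    rw [h.swap₂₃.swap₁₂.mem_peirce_iff]
    exact h.sharpMul_inPeirce ha hx
  refine LinearMap.finrank_le_finrank_of_injective
    (f := (A.sharp.polarBilin a).restrict hmap) ?_
  rw [← LinearMap.ker_eq_bot, LinearMap.ker_eq_bot']
  rintro ⟨x, hx⟩ h0
  have h1 : A.sharpMul a x = 0 := congrArg Subtype.val h0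
  rw [h.swap₁₂.mem_peirce_iff] at hx
  have h2 := h.sharpMul_sharpMul_same_right ha hx
  rw [h1, sharpMul_zero_right] at h2
  exact Subtype.ext ((smul_eq_zero.1 h2.symm).resolve_left (neg_ne_zero.2 hq))

theorem finrank_eq [Module.Finite k J] (h : A.IsFrame e₁ e₂ e₃) (hA : A.Nondegenerate)
    (hne : A.peirce e₂ e₃ ≠ ⊥) :
    Module.finrank k (A.peirce e₁ e₃) = Module.finrank k (A.peirce e₁ e₂) :=
  le_antisymm (h.finrank_le hA hne) (h.swap₂₃.finrank_le hA (by rwa [peirce_comm]))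

/-- The Peirce decomposition as a linear map. -/
noncomputable def peirceMap (A : CubicJordan k J) (e₁ e₂ e₃ : J) :
    J →ₗ[k] (k × k × k) × A.peirce e₂ e₃ × A.peirce e₁ e₃ × A.peirce e₁ e₂ :=
  ((A.T e₁).prod ((A.T e₂).prod (A.T e₃))).prod
    ((A.U (e₂ + e₃) - A.U e₂ - A.U e₃).rangeRestrict.prod
      ((A.U (e₁ + e₃) - A.U e₁ - A.U e₃).rangeRestrict.prod
        (A.U (e₁ + e₂) - A.U e₁ - A.U e₂).rangeRestrict))

theorem peirceMap_bijective (h : A.IsFrame e₁ e₂ e₃) :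
    Function.Bijective (peirceMap A e₁ e₂ e₃) := by
  constructor
  · rw [← LinearMap.ker_eq_bot, LinearMap.ker_eq_bot']
    intro x hx
    have h1 : A.T e₁ x = 0 := congrArg (fun p => p.1.1) hx
    have h2 : A.T e₂ x = 0 := congrArg (fun p => p.1.2.1) hx
    have h3 : A.T e₃ x = 0 := congrArg (fun p => p.1.2.2) hx
    have h4 : (A.U (e₂ + e₃) - A.U e₂ - A.U e₃) x = 0 := congrArg (fun p => (p.2.1 : J)) hx
    have h5 : (A.U (e₁ + e₃) - A.U e₁ - A.U e₃) x = 0 := congrArg (fun p => (p.2.2.1 : J)) hx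
    have h6 : (A.U (e₁ + e₂) - A.U e₁ - A.U e₂) x = 0 := congrArg (fun p => (p.2.2.2 : J)) hx
    rw [h.U_apply_eq] at h4
    rw [h.swap₁₂.U_apply_eq] at h5
    rw [h.swap₂₃.swap₁₂.U_apply_eq] at h6
    rw [h.decomposition x, h4, h5, h6, h1, h2, h3]
    simp
  · rintro ⟨⟨α, β, γ⟩, ⟨a, ha⟩, ⟨b, hb⟩, ⟨c, hc⟩⟩
    have ha' := (h.mem_peirce_iff a).1 ha
    have hb' := (h.swap₁₂.mem_peirce_iff b).1 hb
    have hc' := (h.swap₂₃.swap₁₂.mem_peirce_iff c).1 hc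
    have t11 := h.T_self
    have t22 := h.swap₁₂.T_self
    have t33 := h.swap₂₃.swap₁₂.T_self
    have t12 := h.T₁₂
    have t13 := h.T₁₃
    have t21 := h.swap₁₂.T₁₂
    have t23 := h.swap₁₂.T₁₃
    have t31 := h.swap₂₃.swap₁₂.T₁₂
    have t32 := h.swap₂₃.swap₁₂.T₁₃
    have m21 := A.sharpMul_comm e₂ e₁
    have m31 := A.sharpMul_comm e₃ e₁
    have m32 := A.sharpMul_comm e₃ e₂
    refine ⟨α • e₁ + β • e₂ + γ • e₃ + a + b + c, ?_⟩
    refine Prod.ext (Prod.ext ?_ (Prod.ext ?_ ?_))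
      (Prod.ext (Subtype.ext ?_) (Prod.ext (Subtype.ext ?_) (Subtype.ext ?_)))
    · change A.T e₁ _ = α
      simp [t11, t12, t13, ha'.T₁, hb'.T₂, hc'.T₂]
    · change A.T e₂ _ = β
      simp [t21, t22, t23, ha'.T₂, hb'.T₁, hc'.T₃]
    · change A.T e₃ _ = γ
      simp [t31, t32, t33, ha'.T₃, hb'.T₃, hc'.T₁]
    · change (A.U (e₂ + e₃) - A.U e₂ - A.U e₃) _ = a
      rw [h.U_apply_eq]
      simp [t21, t22, t23, ha'.T₂, hb'.T₁, hc'.T₃, t31, t32, t33, ha'.T₃, hb'.T₃, hc'.T₁,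
        sharpMul_add_right, sharpMul_smul_right, sharpMul_self, h.sharp₁, h.mul₁₂, h.mul₁₃,
        ha'.mul₁, hb'.mul₂, hc'.mul₂]
    · change (A.U (e₁ + e₃) - A.U e₁ - A.U e₃) _ = b
      rw [h.swap₁₂.U_apply_eq]
      simp [t11, t12, t13, ha'.T₁, hb'.T₂, hc'.T₂, t31, t32, t33, ha'.T₃, hb'.T₃, hc'.T₁,
        sharpMul_add_right, sharpMul_smul_right, sharpMul_self, h.sharp₂, m21, h.mul₁₂, h.mul₂₃,
        ha'.mul₂, hb'.mul₁, hc'.mul₃]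
    · change (A.U (e₁ + e₂) - A.U e₁ - A.U e₂) _ = c
      rw [h.swap₂₃.swap₁₂.U_apply_eq]
      simp [t21, t22, t23, ha'.T₂, hb'.T₁, hc'.T₃, t11, t12, t13, ha'.T₁, hb'.T₂, hc'.T₂,
        sharpMul_add_right, sharpMul_smul_right, sharpMul_self, h.sharp₃, m31, m32, h.mul₁₃,
        h.mul₂₃, ha'.mul₃, hb'.mul₃, hc'.mul₁]

theorem finrank_eq_sum [Module.Finite k J] (h : A.IsFrame e₁ e₂ e₃) :
    Module.finrank k J = 3 + (Module.finrank k (A.peirce e₂ e₃) +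
      (Module.finrank k (A.peirce e₁ e₃) + Module.finrank k (A.peirce e₁ e₂))) := by
  rw [(LinearEquiv.ofBijective _ h.peirceMap_bijective).finrank_eq]
  simp [Module.finrank_prod]

/-- If `J₁₃` and `J₁₂` vanish, then `J` splits off the summand `k e₁`. -/
theorem U_apply_of_split (h : A.IsFrame e₁ e₂ e₃) (h13 : A.peirce e₁ e₃ = ⊥)
    (h12 : A.peirce e₁ e₂ = ⊥) {v w : J} (hv : A.T e₁ v = 0) (hw : A.T e₁ w = 0) (α δ : k) :
    A.U (α • e₁ + v) (δ • e₁ + w) = (α ^ 2 * δ) • e₁ +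
      (A.T e₁ (A.sharpMul v (A.T e₁ (A.sharpMul w (e₂ + e₃)) • (e₂ + e₃) - w)) • v -
        A.T e₁ (A.sharp v) • (A.T e₁ (A.sharpMul w (e₂ + e₃)) • (e₂ + e₃) - w)) := by
  have dec (v : J) (hv : A.T e₁ v = 0) : ∃ a, A.InPeirce e₁ e₂ e₃ a ∧
      v = A.T e₂ v • e₂ + A.T e₃ v • e₃ + a := by
    refine ⟨_, h.inPeirce_proj v, ?_⟩
    have hb := (h.swap₁₂.mem_peirce_iff _).2 (h.swap₁₂.inPeirce_proj v)
    have hc := (h.swap₂₃.swap₁₂.mem_peirce_iff _).2 (h.swap₂₃.swap₁₂.inPeirce_proj v)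
    rw [h13, Submodule.mem_bot] at hb
    rw [h12, Submodule.mem_bot] at hc
    have hd := h.decomposition v
    rw [hb, hc, hv] at hd
    linear_combination (norm := module) hd
  -- On the complement `k e₂ + k e₃ + J₂₃` of `e₁` the sharp is `Q(v) e₁`, with `Q(β e₂ + γ e₃ + a)
  -- = βγ + q(a)`.
  have sharp_eq (v : J) (hv : A.T e₁ v = 0) : A.sharp v = A.T e₁ (A.sharp v) • e₁ := by
    obtain ⟨a, ha, hva⟩ := dec v hv
    have h1 (β γ : k) : A.sharp (β • e₂ + γ • e₃ + a) =
        (β * γ + A.T e₁ (A.sharp a)) • e₁ := by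
      simp only [sharp_add, sharp_smul, h.sharp₂, h.sharp₃, sharpMul_add_left, sharpMul_smul_left,
        sharpMul_smul_right, h.mul₂₃, ha.mul₂, ha.mul₃]
      linear_combination (norm := module) h.sharp_eq ha
    rw [hva, h1, map_smul, h.T_self, smul_eq_mul, mul_one]
  have mul_eq (v w : J) (hv : A.T e₁ v = 0) (hw : A.T e₁ w = 0) :
      A.sharpMul v w = A.T e₁ (A.sharpMul v w) • e₁ := by
    have h1 := sharp_eq (v + w) (by rw [map_add, hv, hw, add_zero])
    rw [sharp_add, map_add, map_add] at h1
    linear_combination (norm := module) h1 - sharp_eq v hv - sharp_eq w hw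
  -- Multiplication by `e₁` is the conjugation of `J(Q, e₂ + e₃)`, since `Q(v, e₂ + e₃) = T(v)`.
  have bar (v : J) (hv : A.T e₁ v = 0) : A.sharpMul e₁ v = A.tr v • (e₂ + e₃) - v := by
    obtain ⟨a, ha, hva⟩ := dec v hv
    have h1 : A.sharpMul e₁ v = A.T e₂ v • e₃ + A.T e₃ v • e₂ - a := by
      conv_lhs => rw [hva]
      simp only [sharpMul_add_right, sharpMul_smul_right, h.mul₁₂, h.mul₁₃, ha.mul₁]
      abel
    rw [h1, h.tr_eq_sum, hv]
    linear_combination (norm := module) hva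
  have pair_one (v : J) (hv : A.T e₁ v = 0) : A.T e₁ (A.sharpMul v (e₂ + e₃)) = A.tr v := by
    rw [sharpMul_comm, T_sharpMul_right, sharpMul_comm, sharpMul_add_right, h.mul₁₂, h.mul₁₃,
      h.tr_eq_sum, hv]
    simp [add_comm]
  have hTvw : A.T v w = A.tr w * A.tr v - A.T e₁ (A.sharpMul v w) := by
    have h1 := A.T_eq v w
    rw [mul_eq v w hv hw, tr_smul, h.tr₁] at h1
    rw [h1]; ring
  have hbb : A.sharpMul e₁ (A.sharpMul e₁ v) = v := by
    rw [h.sharpMul_sharpMul_self, hv, bar v hv, ← h.sum]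
    module
  have hbv : A.T e₁ (A.sharpMul e₁ v) = 0 := by
    rw [T_sharpMul_right, sharpMul_self, h.sharp₁]; simp
  have hvw : A.sharpMul (A.sharpMul e₁ v) w = A.T v w • e₁ := by
    rw [mul_eq _ _ hbv hw, bar v hv, sharpMul_sub_left, sharpMul_smul_left, map_sub, map_smul,
      sharpMul_comm A (e₂ + e₃), pair_one w hw, hTvw, smul_eq_mul, mul_comm]
  have hs : A.sharp (α • e₁ + v) = A.T e₁ (A.sharp v) • e₁ + α • A.sharpMul e₁ v := by
    rw [sharp_add, sharp_smul, h.sharp₁, ← sharp_eq v hv, sharpMul_smul_left]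
    simp
  have hv' : A.T v e₁ = 0 := by rw [T_comm]; exact hv
  rw [U_apply, hs, pair_one w hw, sharpMul_sub_right, sharpMul_smul_right, map_sub, map_smul,
    pair_one v hv, smul_eq_mul, ← hTvw, ← bar w hw]
  simp only [map_add, map_smul, LinearMap.add_apply, LinearMap.smul_apply, h.T_self, hw, hv',
    smul_eq_mul, sharpMul_add_left, sharpMul_add_right, sharpMul_smul_left, sharpMul_smul_right,
    sharpMul_self, h.sharp₁, hvw, sharpMul_comm A (A.sharpMul e₁ v) e₁, hbb]
  module

/-- The quadratic summand is the kernel of `T(e₁, ·)` with `Q(v) = T(e₁, v^♯)` and identity `e₂ +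
e₃`. -/
theorem isFieldPlusQuadratic (h : A.IsFrame e₁ e₂ e₃) (h13 : A.peirce e₁ e₃ = ⊥)
    (h12 : A.peirce e₁ e₂ = ⊥) : A.IsFieldPlusQuadratic := by
  let V := LinearMap.ker (A.T e₁)
  have hc : e₂ + e₃ ∈ V := by simp [V, h.T₁₂, h.T₁₃]
  let Q : QuadraticForm k V := ((A.T e₁).compQuadraticMap A.sharp).comp V.subtype
  have hQ (v : V) : Q v = A.T e₁ (A.sharp v) := rfl
  have hQp (v w : V) : QuadraticMap.polar Q v w = A.T e₁ (A.sharpMul v w) := by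
    simp [QuadraticMap.polar, hQ, sharpMul]
  have hproj (x : J) : x - A.T e₁ x • e₁ ∈ V := by simp [V, h.T_self]
  let φ : J ≃ₗ[k] k × V :=
    { toFun := fun x => (A.T e₁ x, ⟨x - A.T e₁ x • e₁, hproj x⟩)
      map_add' := fun x y => by
        ext
        · simp
        · simp only [map_add, Prod.snd_add, Submodule.coe_add]
          module
      map_smul' := fun t x => by
        ext
        · simp
        · simp only [map_smul, Prod.smul_snd, Submodule.coe_smul, RingHom.id_apply, smul_eq_mul]
          module
      invFun := fun p => p.1 • e₁ + p.2
      left_inv := fun x => by simp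
      right_inv := fun p => by
        obtain ⟨t, v, hv⟩ := p
        have hv : A.T e₁ v = 0 := hv
        ext <;> simp [h.T_self, hv] }
  refine ⟨V, inferInstance, inferInstance, Q, ⟨e₂ + e₃, hc⟩, φ, ?_, ?_, ?_⟩
  · rw [hQ]
    simp [sharp_add, h.sharp₂, h.sharp₃, h.mul₂₃, h.T_self]
  · have h1 : A.T e₁ A.one = 1 := h.tr₁
    ext
    · exact h1
    · change A.one - A.T e₁ A.one • e₁ = e₂ + e₃
      rw [h1, ← h.sum]
      module
  · intro x y
    apply φ.symm.injective
    rw [LinearEquiv.symm_apply_apply]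
    have hx : x = A.T e₁ x • e₁ + (x - A.T e₁ x • e₁) := by abel
    have hy : y = A.T e₁ y • e₁ + (y - A.T e₁ y • e₁) := by abel
    have key := h.U_apply_of_split h13 h12 (hproj x) (hproj y) (A.T e₁ x) (A.T e₁ y)
    rw [← hx, ← hy] at key
    rw [key]
    simp only [quadraticFormU, hQp, hQ]
    rfl

/-- The three dimensions add up to 6, and a nonzero one forces the other two to be equal. If one
were zero, a second would be too, which `hc` excludes; so all are nonzero and equal. -/
theorem finrank_peirce_eq_two (h : A.IsFrame e₁ e₂ e₃) (hdim : Module.finrank k J = 9)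
    (hA : A.Nondegenerate) (hc : ¬ A.IsFieldPlusQuadratic) :
    Module.finrank k (A.peirce e₂ e₃) = 2 ∧ Module.finrank k (A.peirce e₁ e₃) = 2 ∧
      Module.finrank k (A.peirce e₁ e₂) = 2 := by
  have : Module.Finite k J := Module.finite_of_finrank_eq_succ hdim
  have hsum := h.finrank_eq_sum
  have f1 := h.finrank_eq hA
  have f2 := h.swap₁₂.finrank_eq hA
  have f3 := h.swap₂₃.swap₁₂.finrank_eq hA
  have s1 := h.isFieldPlusQuadratic
  have s2 := h.swap₁₂.isFieldPlusQuadratic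
  have s3 := h.swap₂₃.swap₁₂.isFieldPlusQuadratic
  rw [peirce_comm e₂ e₁] at f2 s2
  rw [peirce_comm e₃ e₂, peirce_comm e₃ e₁] at f3 s3
  have z (S : Submodule k J) : S = ⊥ ↔ Module.finrank k S = 0 := Submodule.finrank_eq_zero.symm
  rw [ne_eq, z] at f1 f2 f3
  rw [z, z] at s1 s2 s3
  have s1' := fun a : _ ∧ _ => hc (s1 a.1 a.2)
  have s2' := fun a : _ ∧ _ => hc (s2 a.1 a.2)
  have s3' := fun a : _ ∧ _ => hc (s3 a.1 a.2)
  rw [imp_false] at s1' s2' s3'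
  clear s1 s2 s3 z
  omega

end IsFrame

end CubicJordan

/-! ### Hyperbolic pairs and matrix units. -/

namespace CubicJordan

variable {k : Type*} {J : Type*} [Field k] [AddCommGroup J] [Module k J]
variable {A : CubicJordan k J} {e₁ e₂ e₃ : J}

/-- A hyperbolic pair of a Peirce space `J₂₃`. -/
structure IsHyperbolicPair (A : CubicJordan k J) (e₁ e₂ e₃ x y : J) : Prop where
  left : A.InPeirce e₁ e₂ e₃ x
  right : A.InPeirce e₁ e₂ e₃ y
  sharp_left : A.sharp x = 0
  sharp_right : A.sharp y = 0
  mul : A.sharpMul x y = -e₁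

namespace IsFrame

variable [Infinite k]

theorem exists_basis_of_isHyperbolicPair (h : A.IsFrame e₁ e₂ e₃)
    (hd : Module.finrank k (A.peirce e₂ e₃) = 2) {x y : J}
    (hxy : A.IsHyperbolicPair e₁ e₂ e₃ x y) :
    ∃ b : Module.Basis (Fin 2) k (A.peirce e₂ e₃), (b 0 : J) = x ∧ (b 1 : J) = y := by
  have he : e₁ ≠ 0 := fun h0 => by simpa [h0, tr] using h.tr₁
  let v : Fin 2 → A.peirce e₂ e₃ :=
    ![⟨x, (h.mem_peirce_iff x).2 hxy.left⟩, ⟨y, (h.mem_peirce_iff y).2 hxy.right⟩]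
  have hv : LinearIndependent k v := by
    rw [LinearIndependent.pair_iff]
    intro s t hst
    have hst : s • x + t • y = 0 := congrArg Subtype.val hst
    have h1 : s • -e₁ = 0 := by
      have := congrArg (fun z => A.sharpMul z y) hst
      simpa [sharpMul_add_left, sharpMul_smul_left, sharpMul_self, hxy.sharp_right, hxy.mul,
        sharpMul_zero_left] using this
    have h2 : t • -e₁ = 0 := by
      have := congrArg (fun z => A.sharpMul x z) hst
      simpa [sharpMul_add_right, sharpMul_smul_right, sharpMul_self, hxy.sharp_left, hxy.mul,
        sharpMul_zero_right] using this
    exact ⟨(smul_eq_zero.1 h1).resolve_right (neg_ne_zero.2 he),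
      (smul_eq_zero.1 h2).resolve_right (neg_ne_zero.2 he)⟩
  have : Module.Finite k (A.peirce e₂ e₃) := Module.finite_of_finrank_eq_succ hd
  refine ⟨basisOfLinearIndependentOfCardEqFinrank hv (by rw [hd]; rfl), ?_, ?_⟩ <;>
    simp [v]

theorem exists_isHyperbolicPair [IsAlgClosed k] (h : A.IsFrame e₁ e₂ e₃) (hA : A.Nondegenerate)
    (hd : Module.finrank k (A.peirce e₂ e₃) = 2) :
    ∃ x y, A.IsHyperbolicPair e₁ e₂ e₃ x y := by
  have hiso : ∃ x, A.InPeirce e₁ e₂ e₃ x ∧ x ≠ 0 ∧ A.sharp x = 0 := by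
    have : Module.Finite k (A.peirce e₂ e₃) := Module.finite_of_finrank_eq_succ hd
    let b := Module.finBasisOfFinrankEq k (A.peirce e₂ e₃) hd
    have hu := (h.mem_peirce_iff _).1 (b 0).2
    have hv := (h.mem_peirce_iff _).1 (b 1).2
    have hind : ∀ s t : k, s • (b 0 : J) + t • (b 1 : J) = 0 → s = 0 ∧ t = 0 := by
      intro s t hst
      have h1 := Fintype.linearIndependent_iff.1 b.linearIndependent ![s, t]
        (by rw [Fin.sum_univ_two]; exact Subtype.ext hst)
      exact ⟨h1 0, h1 1⟩
    generalize (b 0 : J) = u at hu hind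
    generalize (b 1 : J) = v at hv hind
    -- Either `v` is isotropic, or `q(u + t v)` has degree exactly two in `t` and so has a root.
    by_cases hq : A.T e₁ (A.sharp v) = 0
    · refine ⟨v, hv, fun h0 => one_ne_zero (hind 0 1 (by simp [h0])).2, ?_⟩
      rw [h.sharp_eq hv, hq, zero_smul]
    · obtain ⟨t, ht⟩ := IsAlgClosed.exists_root
        (Polynomial.C (A.T e₁ (A.sharp v)) * Polynomial.X ^ 2 +
          Polynomial.C (A.T e₁ (A.sharpMul u v)) * Polynomial.X +
          Polynomial.C (A.T e₁ (A.sharp u))) (by rw [Polynomial.degree_quadratic hq]; decide)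
      simp only [Polynomial.IsRoot, Polynomial.eval_add, Polynomial.eval_mul, Polynomial.eval_C,
        Polynomial.eval_X, Polynomial.eval_pow] at ht
      refine ⟨u + t • v, hu.add (hv.smul t), fun h0 => ?_, ?_⟩
      · exact one_ne_zero (hind 1 t (by rw [one_smul, h0])).1
      · rw [h.sharp_eq (hu.add (hv.smul t)), sharp_add, sharp_smul, sharpMul_smul_right]
        simp only [map_add, map_smul, smul_eq_mul]
        rw [show A.T e₁ (A.sharp u) + t ^ 2 * A.T e₁ (A.sharp v) + t * A.T e₁ (A.sharpMul u v) = 0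
          by linear_combination ht, zero_smul]
  obtain ⟨x, hx, hx0, hxs⟩ := hiso
  have hy : ∃ y, A.InPeirce e₁ e₂ e₃ y ∧ A.T e₁ (A.sharpMul x y) ≠ 0 := by
    by_contra! hr
    refine hx0 (h.eq_zero_of_radical hA hx hxs fun y hy => ?_)
    rw [h.sharpMul_eq hx hy, hr y hy, zero_smul]
  obtain ⟨y, hy, hxy⟩ := hy
  set c := A.T e₁ (A.sharpMul x y) with hc
  set q := A.T e₁ (A.sharp y) with hq
  have hm : A.sharpMul x y = c • e₁ := h.sharpMul_eq hx hy
  have hs : A.sharp y = q • e₁ := h.sharp_eq hy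
  -- Scaling `y` by `-c⁻¹` normalizes the product with `x` to `-e₁`. Adding a multiple of the
  -- isotropic `x` preserves that product and is chosen to make the second vector isotropic.
  refine ⟨x, (-c⁻¹) • y + (c⁻¹ * c⁻¹ * q) • x, hx, (hy.smul _).add (hx.smul _), hxs, ?_, ?_⟩
  · rw [sharp_add, sharp_smul, sharp_smul, hxs, hs, sharpMul_smul_left, sharpMul_smul_right,
      sharpMul_comm A y x, hm, smul_zero, add_zero, smul_smul, smul_smul, smul_smul, ← add_smul]
    rw [show (-c⁻¹) ^ 2 * q + -c⁻¹ * (c⁻¹ * c⁻¹ * q) * c = 0 by field_simp; ring, zero_smul]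
  · rw [sharpMul_add_right, sharpMul_smul_right, sharpMul_smul_right, sharpMul_self, hxs, hm,
      smul_zero, smul_zero, add_zero, smul_smul, neg_mul, inv_mul_cancel₀ hxy, neg_one_smul]

/-- The `♯`-product with an isotropic element of `J₂₃` maps `J₁₃` to isotropic elements. -/
theorem sharp_sharpMul_eq_zero (h : A.IsFrame e₁ e₂ e₃) {a x : J}
    (ha : A.InPeirce e₁ e₂ e₃ a) (hs : A.sharp a = 0) (hx : A.InPeirce e₂ e₁ e₃ x) :
    A.sharp (A.sharpMul a x) = 0 := by
  have h1 := A.sharp_sharpMul a x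
  rw [hs, h.swap₁₂.sharp_eq hx] at h1
  simpa [sharpMul_zero_left, ha.T₂] using h1

theorem sharpMul_sharpMul_of_sharp_eq_zero (h : A.IsFrame e₁ e₂ e₃) {a x : J}
    (ha : A.InPeirce e₁ e₂ e₃ a) (hs : A.sharp a = 0) (hx : A.InPeirce e₂ e₁ e₃ x) :
    A.sharpMul a (A.sharpMul a x) = 0 := by
  rw [h.sharpMul_sharpMul_same_right ha hx, hs]; simp

/-- Hyperbolic pairs of the three Peirce spaces which multiply like the off-diagonal matrix units
of the `3 × 3` matrices. -/
theorem exists_matrixUnits [IsAlgClosed k] (h : A.IsFrame e₁ e₂ e₃) (hA : A.Nondegenerate)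
    (hd₁ : Module.finrank k (A.peirce e₂ e₃) = 2)
    (hd₂ : Module.finrank k (A.peirce e₁ e₃) = 2) :
    ∃ x x' y y' z z' : J, A.IsHyperbolicPair e₁ e₂ e₃ x x' ∧ A.IsHyperbolicPair e₂ e₁ e₃ y y' ∧
      A.IsHyperbolicPair e₃ e₁ e₂ z z' ∧
      A.sharpMul x y = z' ∧ A.sharpMul x y' = 0 ∧ A.sharpMul x' y = 0 ∧ A.sharpMul x' y' = z ∧
      A.sharpMul x z = y' ∧ A.sharpMul x z' = 0 ∧ A.sharpMul x' z = 0 ∧ A.sharpMul x' z' = y ∧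
      A.sharpMul y z = x' ∧ A.sharpMul y z' = 0 ∧ A.sharpMul y' z = 0 ∧ A.sharpMul y' z' = x := by
  obtain ⟨x, x', hx⟩ := h.exists_isHyperbolicPair hA hd₁
  obtain ⟨w, hw, hwq⟩ := h.swap₁₂.exists_sharp_ne_zero hA (fun h0 => by
    rw [h0, finrank_bot] at hd₂; exact absurd hd₂ (by decide))
  -- Write `L` for `♯`-multiplication. As `L_x² = L_x'² = 0`, this relation makes `L_x L_x'` and
  -- `L_x' L_x` complementary projections of `J₁₃`.
  have anti {u : J} (hu : A.InPeirce e₂ e₁ e₃ u) :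
      A.sharpMul x (A.sharpMul x' u) + A.sharpMul x' (A.sharpMul x u) = u := by
    rw [h.sharpMul_sharpMul_add_swap hx.left hx.right hu, hx.mul, map_neg, h.T_self]; simp
  have to12 {a u : J} (ha : A.InPeirce e₁ e₂ e₃ a) (hu : A.InPeirce e₂ e₁ e₃ u) :
      A.InPeirce e₃ e₁ e₂ (A.sharpMul a u) := h.sharpMul_inPeirce ha hu
  have to13 {a u : J} (ha : A.InPeirce e₁ e₂ e₃ a) (hu : A.InPeirce e₃ e₁ e₂ u) :
      A.InPeirce e₂ e₁ e₃ (A.sharpMul a u) := h.swap₂₃.sharpMul_inPeirce ha.swap hu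
  set c := A.T e₂ (A.sharp w) with hc
  -- The two projections of `w` are isotropic with sum `w`, so their product is `w^♯ = c e₂`; the
  -- factor `-c⁻¹` turns it into `-e₂`.
  obtain ⟨y, hydef⟩ : ∃ y, y = (-c⁻¹) • A.sharpMul x' (A.sharpMul x w) := ⟨_, rfl⟩
  obtain ⟨y', hydef'⟩ : ∃ y', y' = A.sharpMul x (A.sharpMul x' w) := ⟨_, rfl⟩
  have ysharp' : A.sharp y' = 0 := by
    rw [hydef']
    exact h.swap₂₃.sharp_sharpMul_eq_zero hx.left.swap hx.sharp_left (to12 hx.right hw)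
  have ysharp0 : A.sharp (A.sharpMul x' (A.sharpMul x w)) = 0 :=
    h.swap₂₃.sharp_sharpMul_eq_zero hx.right.swap hx.sharp_right (to12 hx.left hw)
  have hy : A.IsHyperbolicPair e₂ e₁ e₃ y y' := by
    refine ⟨?_, ?_, ?_, ysharp', ?_⟩
    · rw [hydef]; exact (to13 hx.right (to12 hx.left hw)).smul _
    · rw [hydef']; exact to13 hx.left (to12 hx.right hw)
    · rw [hydef, sharp_smul, ysharp0, smul_zero]
    · have h1 := h.swap₁₂.sharp_eq hw
      rw [← hc] at h1
      conv_lhs at h1 => rw [← anti hw]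
      rw [sharp_add, ysharp0, ← hydef', ysharp', zero_add, zero_add, sharpMul_comm] at h1
      rw [hydef, sharpMul_smul_left, h1, smul_smul, neg_mul, inv_mul_cancel₀ hwq, neg_one_smul]
  have xy' : A.sharpMul x y' = 0 := by
    rw [hydef']
    exact h.swap₂₃.sharpMul_sharpMul_of_sharp_eq_zero hx.left.swap hx.sharp_left (to12 hx.right hw)
  have x'y : A.sharpMul x' y = 0 := by
    rw [hydef, sharpMul_smul_right, h.swap₂₃.sharpMul_sharpMul_of_sharp_eq_zero hx.right.swap
      hx.sharp_right (to12 hx.left hw), smul_zero]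
  have anti' {u : J} (hu : A.InPeirce e₁ e₂ e₃ u) :
      A.sharpMul y (A.sharpMul y' u) + A.sharpMul y' (A.sharpMul y u) = u := by
    rw [h.swap₁₂.sharpMul_sharpMul_add_swap hy.left hy.right hu, hy.mul, map_neg,
      h.swap₁₂.T_self]
    simp
  refine ⟨x, x', y, y', A.sharpMul x' y', A.sharpMul x y, hx, hy, ⟨to12 hx.right hy.right,
    to12 hx.left hy.left, h.sharp_sharpMul_eq_zero hx.right hx.sharp_right hy.right,
    h.sharp_sharpMul_eq_zero hx.left hx.sharp_left hy.left, ?_⟩, rfl, xy', x'y, rfl, ?_,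
    h.sharpMul_sharpMul_of_sharp_eq_zero hx.left hx.sharp_left hy.left,
    h.sharpMul_sharpMul_of_sharp_eq_zero hx.right hx.sharp_right hy.right, ?_, ?_, ?_, ?_, ?_⟩
  -- In the full linearization the mixed products `x ♯ y'` and `x' ♯ y` vanish, leaving `z ♯ z' + e₁
  -- ♯ e₂ = 0`.
  · have h1 := A.sharpMul_sharpMul x' y y' x
    rw [xy', x'y, A.sharpMul_comm x' x, hx.mul, A.sharpMul_comm y' y, hy.mul,
      A.T_sharpMul_rotate x' y' y, A.sharpMul_comm y' y, hy.mul] at h1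
    simp only [sharpMul_neg_left, sharpMul_neg_right, sharpMul_zero_left, h.mul₁₂, map_neg,
      LinearMap.neg_apply, hy.left.T₂, hy.right.T₂, hx.right.T₂, map_zero,
      LinearMap.zero_apply, zero_smul, neg_zero, add_zero, neg_neg] at h1
    exact eq_neg_of_add_eq_zero_left h1
  -- In `anti` and `anti'` one of the two summands is zero, and the other is the product sought.
  · simpa [x'y, xy', sharpMul_zero_right] using anti hy.right
  · simpa [x'y, xy', sharpMul_zero_right] using anti hy.left
  · simpa [x'y, sharpMul_comm A y x', sharpMul_comm A y' x', sharpMul_zero_right] using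
      anti' hx.right
  · rw [sharpMul_comm A x y]
    exact h.swap₁₂.sharpMul_sharpMul_of_sharp_eq_zero hy.left hy.sharp_left hx.left
  · rw [sharpMul_comm A x' y']
    exact h.swap₁₂.sharpMul_sharpMul_of_sharp_eq_zero hy.right hy.sharp_right hx.right
  · simpa [xy', sharpMul_comm A y x, sharpMul_comm A y' x, sharpMul_zero_right] using
      anti' hx.left

end IsFrame

end CubicJordan

theorem proposition3p2 {k : Type*} [Field k] [IsAlgClosed k]
    {J : Type*} [AddCommGroup J] [Module k J] (hdim : Module.finrank k J = 9)
    (A : CubicJordan k J)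
    (ha : A.Nondegenerate)
    (hb : ∃ x : J, x ≠ 0 ∧ A.N x ≠ 0)
    (hc : ¬ A.IsFieldPlusQuadratic)
    (υ₁ υ₂ υ₃ : J) (hυ : A.AreComplementary υ₁ υ₂ υ₃) :
    ∃ (χ₁ : Module.Basis (Fin 2) k (A.peirce υ₂ υ₃))
      (χ₂ : Module.Basis (Fin 2) k (A.peirce υ₁ υ₃))
      (χ₃ : Module.Basis (Fin 2) k (A.peirce υ₁ υ₂))
      (p : Fin 2 → Fin 2 → Fin 2 → k),
      A.sharpMul (χ₁ 0) (χ₂ 0) =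
        p 1 1 0 • (χ₃ 0 : J) + p 1 1 1 • (χ₃ 1 : J) ∧
      A.sharpMul (χ₁ 0) (χ₂ 1) =
        -p 1 0 0 • (χ₃ 0 : J) - p 1 0 1 • (χ₃ 1 : J) ∧
      A.sharpMul (χ₁ 1) (χ₂ 0) =
        -p 0 1 0 • (χ₃ 0 : J) - p 0 1 1 • (χ₃ 1 : J) ∧
      A.sharpMul (χ₁ 1) (χ₂ 1) =
        p 0 0 0 • (χ₃ 0 : J) + p 0 0 1 • (χ₃ 1 : J) ∧
      A.sharpMul (χ₁ 0) (χ₃ 0) =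
        p 1 0 1 • (χ₂ 0 : J) + p 1 1 1 • (χ₂ 1 : J) ∧
      A.sharpMul (χ₁ 0) (χ₃ 1) =
        -p 1 0 0 • (χ₂ 0 : J) - p 1 1 0 • (χ₂ 1 : J) ∧
      A.sharpMul (χ₁ 1) (χ₃ 0) =
        -p 0 0 1 • (χ₂ 0 : J) - p 0 1 1 • (χ₂ 1 : J) ∧
      A.sharpMul (χ₁ 1) (χ₃ 1) =
        p 0 0 0 • (χ₂ 0 : J) + p 0 1 0 • (χ₂ 1 : J) ∧
      A.sharpMul (χ₂ 0) (χ₃ 0) =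
        p 0 1 1 • (χ₁ 0 : J) + p 1 1 1 • (χ₁ 1 : J) ∧
      A.sharpMul (χ₂ 0) (χ₃ 1) =
        -p 0 1 0 • (χ₁ 0 : J) - p 1 1 0 • (χ₁ 1 : J) ∧
      A.sharpMul (χ₂ 1) (χ₃ 0) =
        -p 0 0 1 • (χ₁ 0 : J) - p 1 0 1 • (χ₁ 1 : J) ∧
      A.sharpMul (χ₂ 1) (χ₃ 1) =
        p 0 0 0 • (χ₁ 0 : J) + p 1 0 0 • (χ₁ 1 : J) ∧
      A.sharpMul (χ₁ 0) (χ₁ 0) =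
        (2 * (-p 1 0 1 * p 1 1 0 + p 1 0 0 * p 1 1 1)) • υ₁ ∧
      A.sharpMul (χ₁ 0) (χ₁ 1) =
        (-p 0 1 1 * p 1 0 0 + p 0 1 0 * p 1 0 1 + p 0 0 1 * p 1 1 0 - p 0 0 0 * p 1 1 1) • υ₁ ∧
      A.sharpMul (χ₁ 1) (χ₁ 1) =
        (2 * (-p 0 0 1 * p 0 1 0 + p 0 0 0 * p 0 1 1)) • υ₁ ∧
      A.sharpMul (χ₂ 0) (χ₂ 0) =
        (2 * (-p 0 1 1 * p 1 1 0 + p 0 1 0 * p 1 1 1)) • υ₂ ∧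
      A.sharpMul (χ₂ 0) (χ₂ 1) =
        (p 0 1 1 * p 1 0 0 - p 0 1 0 * p 1 0 1 + p 0 0 1 * p 1 1 0 - p 0 0 0 * p 1 1 1) • υ₂ ∧
      A.sharpMul (χ₂ 1) (χ₂ 1) =
        (2 * (-p 0 0 1 * p 1 0 0 + p 0 0 0 * p 1 0 1)) • υ₂ ∧
      A.sharpMul (χ₃ 0) (χ₃ 0) =
        (2 * (-p 0 1 1 * p 1 0 1 + p 0 0 1 * p 1 1 1)) • υ₃ ∧
      A.sharpMul (χ₃ 0) (χ₃ 1) =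
        (p 0 1 1 * p 1 0 0 + p 0 1 0 * p 1 0 1 - p 0 0 1 * p 1 1 0 - p 0 0 0 * p 1 1 1) • υ₃ ∧
      A.sharpMul (χ₃ 1) (χ₃ 1) =
        (2 * (-p 0 1 0 * p 1 0 0 + p 0 0 0 * p 1 1 0)) • υ₃ := by

  have : Infinite k := inferInstance
  have h := hυ.isFrame ha
  obtain ⟨d₁, d₂, d₃⟩ := h.finrank_peirce_eq_two hdim ha hc
  obtain ⟨x, x', y, y', z, z', hx, hy, hz, m1, m2, m3, m4, m5, m6, m7, m8, m9, m10, m11, m12⟩ :=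
    h.exists_matrixUnits ha d₁ d₂
  obtain ⟨χ₁, hχ₁, hχ₁'⟩ := h.exists_basis_of_isHyperbolicPair d₁ hx
  obtain ⟨χ₂, hχ₂, hχ₂'⟩ := h.swap₁₂.exists_basis_of_isHyperbolicPair d₂ hy
  obtain ⟨χ₃, hχ₃, hχ₃'⟩ := h.swap₂₃.swap₁₂.exists_basis_of_isHyperbolicPair d₃ hz
  -- For the diagonal tensor the only nonzero product within a Peirce space is `-p₁₁₁ p₂₂₂ υᵢ =
  -- -υᵢ`, which is the normalization of the hyperbolic pairs.
  refine ⟨χ₁, χ₂, χ₃, fun a b c => if a = b ∧ b = c then 1 else 0, ?_⟩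
  rw [hχ₁, hχ₁', hχ₂, hχ₂', hχ₃, hχ₃', m1, m2, m3, m4, m5, m6, m7, m8, m9, m10, m11, m12,
    hx.mul, hy.mul, hz.mul]
  simp [CubicJordan.sharpMul_self, hx.sharp_left, hx.sharp_right, hy.sharp_left, hy.sharp_right,
    hz.sharp_left, hz.sharp_right]
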